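/- Let $\tau:\mathbb{N}_{\ge 1}\to\mathbb{Z}$ be Ramanujan's tau function, defined by the identity of formal power series $\sum_{n\ge 1}\tau(n)q^n = q\prod_{n\ge 1}(1-q^n)^{24}$ in $\mathbb{Z}[[q]]$. Let $l\ge 2$ be a prime number and put $\Delta(l)=\tau(l)^2-4\,l^{11}$. Then for every prime number $p$ coprime to $\Delta(l)$, where $\left(\frac{\cdot}{p}\right)$ denotes the Legendre symbol (for $a$ coprime to $p$, $\left(\frac{a}{p}\right)=1$ if $a$ is a square modulo $p$ and $-1$ otherwise): 1. if $\left(\frac{\Delta(l)}{p}\right)=1$, then $\tau(l^p)\equiv\tau(l)\pmod p$; 2. if $\left(\frac{\Delta(l)}{p}\right)=-1$, then $\tau(l^p)\equiv 0\pmod p$. -/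

import Mathlib

section RamanujanTau

open PowerSeries
open scoped PowerSeries.WithPiTopology

/-- The infinite product `∏_{n ≥ 1} (1 - q ^ n) ^ 24` converges in `ℤ⟦q⟧`, for the usual topology
on formal power series (coefficientwise convergence, `ℤ` being discrete). -/
theorem multipliable_one_sub_X_pow_pow_24 :
    Multipliable (fun n : ℕ => (1 - (X : ℤ⟦X⟧) ^ (n + 1)) ^ 24) :=
  (PowerSeries.WithPiTopology.multipliable_one_sub_X_pow ℤ).pow 24

/-- The formal power series `q ∏_{n ≥ 1} (1 - q ^ n) ^ 24` with integer coefficients. -/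
noncomputable def ramanujanSeries : ℤ⟦X⟧ :=
  X * ∏' n : ℕ, (1 - (X : ℤ⟦X⟧) ^ (n + 1)) ^ 24

/-- Ramanujan's tau function: `∑_{n ≥ 1} τ(n) q ^ n = q ∏_{n ≥ 1} (1 - q ^ n) ^ 24`. -/
noncomputable def ramanujanTau (n : ℕ) : ℤ :=
  PowerSeries.coeff n ramanujanSeries

/-- `Δ(l) = τ(l)² - 4 l¹¹`, the discriminant of `X² - τ(l) X + l¹¹`. -/
noncomputable def ramanujanDisc (l : ℕ) : ℤ :=
  ramanujanTau l ^ 2 - 4 * (l : ℤ) ^ 11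

end RamanujanTau

/-! By Hecke theory τ(l^(n+2)) = τ(l) τ(l^(n+1)) - l^11 τ(l^n), so n ↦ τ(l^n) is a Lucas sequence:
(α - β) τ(l^p) = α^(p+1) - β^(p+1), with α, β the roots of X² - τ(l) X + l^11, whose discriminant is
Δ(l). For odd p, in an algebraic closure of 𝔽_p, Frobenius fixes α and β when Δ(l) is a nonzero
square mod p and swaps them when it is a nonsquare. The right side is then α² - β² or αβ - βα, and
cancelling α - β ≠ 0 gives τ(l) or 0 (`lucas_prime_mod`).

The case p = 2 never occurs: τ(l) is even (`even_ramanujanTau_of_prime`, from E₄³ - E₆² = 1728 Δ),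
hence so is Δ(l). The recursion (`ramanujanTau_prime_pow_add_two`) holds because level one cusp
forms of weight 12 are multiples of the discriminant, which is therefore a Hecke eigenform. Both
modular inputs need the formal product to be the q-expansion of the analytic discriminant
(`discriminant_qExpansion_coeff`). -/

/-! ### Lucas sequences modulo a prime -/

/-- A Lucas sequence with parameters `t, Q` is `(α ^ (n + 1) - β ^ (n + 1)) / (α - β)`, where
`α, β` are the roots of `X ^ 2 - t X + Q`. -/
theorem lucas_mul_sub_roots {R : Type*} [CommRing R] {u : ℕ → R} {α β : R}
    (h0 : u 0 = 1) (h1 : u 1 = α + β)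
    (hu : ∀ n, u (n + 2) = (α + β) * u (n + 1) - α * β * u n) (n : ℕ) :
    (α - β) * u n = α ^ (n + 1) - β ^ (n + 1) := by
  induction n using Nat.twoStepInduction with
  | zero => simp [h0]
  | one => rw [h1]; ring
  | more n ih1 ih2 =>
    rw [hu]
    linear_combination (α + β) * ih2 - α * β * ih1

/-- The `p`-th term of a Lucas sequence modulo an odd prime `p` not dividing the discriminant. -/
theorem lucas_prime_mod {p : ℕ} [Fact p.Prime] (hp2 : p ≠ 2) {u : ℕ → ℤ} {t Q : ℤ}
    (h0 : u 0 = 1) (h1 : u 1 = t) (hu : ∀ n, u (n + 2) = t * u (n + 1) - Q * u n) :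
    (legendreSym p (t ^ 2 - 4 * Q) = 1 → u p ≡ t [ZMOD p]) ∧
    (legendreSym p (t ^ 2 - 4 * Q) = -1 → u p ≡ 0 [ZMOD p]) := by
  have hp : p.Prime := Fact.out
  obtain ⟨K, _, _, _⟩ : ∃ (K : Type) (_ : Field K) (_ : Algebra (ZMod p) K), IsAlgClosed K :=
    ⟨AlgebraicClosure (ZMod p), inferInstance, inferInstance, inferInstance⟩
  have : CharP K p := charP_of_injective_algebraMap (algebraMap (ZMod p) K).injective p
  have h2 : (2 : K) ≠ 0 := by
    have := (CharP.cast_eq_zero_iff K p 2).not.mpr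
      (fun h => hp2 ((Nat.prime_dvd_prime_iff_eq hp Nat.prime_two).mp h))
    simpa using this
  obtain ⟨δ, hδ⟩ : ∃ δ : K, δ ^ 2 = ((t ^ 2 - 4 * Q : ℤ) : K) :=
    IsAlgClosed.exists_pow_nat_eq _ two_pos
  -- Euler's criterion: δ^(p-1) = (δ²)^((p-1)/2) is the Legendre symbol, so Frobenius multiplies δ
  -- by it.
  have hfrob : δ ^ p = (legendreSym p (t ^ 2 - 4 * Q) : K) * δ := by
    have h := congrArg (algebraMap (ZMod p) K) (legendreSym.eq_pow p (t ^ 2 - 4 * Q))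
    simp only [map_intCast, map_pow] at h
    rw [h, ← hδ, ← pow_mul, ← pow_succ]
    congr 1
    have := hp.eq_two_or_odd'.resolve_left hp2
    obtain ⟨k, hk⟩ := this
    omega
  have fix : ∀ a : ℤ, (a : K) ^ p = a := fun a => by
    have h := congrArg (algebraMap (ZMod p) K) (ZMod.pow_card (a : ZMod p))
    simpa only [map_pow, map_intCast] using h
  have h2p : (2 : K) ^ p = 2 := by simpa using fix 2
  set α : K := (t + δ) / 2 with hα
  set β : K := (t - δ) / 2 with hβ
  have hsum : (t : K) = α + β := by rw [hα, hβ]; field_simp; ring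
  have hprod : (Q : K) = α * β := by
    rw [hα, hβ]; push_cast at hδ; field_simp; linear_combination hδ
  have hdiff : α - β = δ := by rw [hα, hβ]; field_simp; ring
  have key := lucas_mul_sub_roots (u := fun n => (u n : K)) (α := α) (β := β)
    (by simp [h0]) (by simp [h1, hsum])
    (fun n => by simp only [hu, ← hsum, ← hprod]; push_cast; rfl) p
  have hαp : α ^ p = (t + legendreSym p (t ^ 2 - 4 * Q) * δ) / 2 := by
    rw [hα, div_pow, add_pow_char, fix, hfrob, h2p]
  have hβp : β ^ p = (t - legendreSym p (t ^ 2 - 4 * Q) * δ) / 2 := by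
    rw [hβ, div_pow, sub_pow_char, fix, hfrob, h2p]
  -- Splitting α^(p+1) as α^p α lets the Legendre symbol decide between α² - β² and βα - αβ.
  rw [pow_succ, pow_succ, hαp, hβp, hdiff] at key
  have hδ0 : legendreSym p (t ^ 2 - 4 * Q) ≠ 0 → δ ≠ 0 := by
    intro h hz
    rw [hz, zero_pow two_ne_zero] at hδ
    apply h
    rw [legendreSym.eq_zero_iff, ← map_eq_zero (algebraMap (ZMod p) K), map_intCast, ← hδ]
  have conc : ∀ a : ℤ, δ * (u p : K) = δ * a → δ ≠ 0 → u p ≡ a [ZMOD p] := by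
    intro a h hd
    exact (CharP.intCast_eq_intCast K p).mp (mul_left_cancel₀ hd h)
  constructor <;> intro h <;> refine conc _ ?_ (hδ0 (by rw [h]; decide))
  · rw [key, h, hsum, ← hdiff, hα, hβ]
    push_cast
    field_simp
    ring
  · rw [key, h, hα, hβ]
    push_cast
    field_simp
    ring

/-! ### The q-expansion of the modular discriminant -/

section DiscriminantQExpansion

open Filter Topology PowerSeries

theorem tendstoLocallyUniformlyOn_prod_one_sub_pow_pow (k : ℕ) :
    TendstoLocallyUniformlyOn (fun (s : Finset ℕ) (q : ℂ) => (∏ i ∈ s, (1 - q ^ (i + 1))) ^ k)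
      (fun q => (∏' i, (1 - q ^ (i + 1))) ^ k) atTop (Metric.ball 0 1) := by
  have h := ModularForm.multipliableLocallyUniformlyOn_one_sub_pow.hasProdLocallyUniformlyOn
  rw [hasProdLocallyUniformlyOn_iff_tendstoLocallyUniformlyOn] at h
  induction k with
  | zero =>
    simp only [pow_zero]
    exact fun u hu x _ => ⟨Set.univ, univ_mem, .of_forall fun _ _ _ => refl_mem_uniformity hu⟩
  | succ k ih =>
    simp only [pow_succ]
    exact ih.mul₀ h (ModularForm.differentiableOn_tprod_one_sub_pow.continuousOn.pow k)
      ModularForm.differentiableOn_tprod_one_sub_pow.continuousOn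

/-- Weierstrass: locally uniform convergence of holomorphic functions passes to derivatives. At z =
0 this makes the Taylor coefficients of the partial products converge. -/
theorem tendsto_iteratedDeriv_of_tendstoLocallyUniformlyOn {ι : Type*} {l : Filter ι} {U : Set ℂ}
    {F : ι → ℂ → ℂ} {f : ℂ → ℂ} (hU : IsOpen U) (h : TendstoLocallyUniformlyOn F f l U)
    (hF : ∀ i, DifferentiableOn ℂ (F i) U) {z : ℂ} (hz : z ∈ U) (n : ℕ) :
    Tendsto (fun i => iteratedDeriv n (F i) z) l (𝓝 (iteratedDeriv n f z)) := by
  induction n generalizing F f with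
  | zero => simpa using h.tendsto_at hz
  | succ n ih =>
    simp only [iteratedDeriv_succ']
    exact ih (h.deriv (.of_forall hF) hU) (fun i => (hF i).deriv hU)

theorem Polynomial.iteratedDeriv_eval_zero (P : Polynomial ℂ) (n : ℕ) :
    iteratedDeriv n (fun z => P.eval z) 0 = n.factorial * P.coeff n := by
  have h : iteratedDeriv n (fun z => P.eval z) = fun z => (derivative^[n] P).eval z := by
    induction n with
    | zero => simp
    | succ n ih =>
      ext z
      rw [iteratedDeriv_succ, ih, Polynomial.deriv, Function.iterate_succ_apply']
  rw [h]
  simp only [← Polynomial.coeff_zero_eq_eval_zero, Polynomial.coeff_iterate_derivative, zero_add,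
    Nat.descFactorial_self, nsmul_eq_mul]

/-- The polynomial `q ∏_{i ∈ s} (1 - q ^ (i + 1)) ^ 24`. -/
noncomputable def discriminantPartialProd (s : Finset ℕ) : Polynomial ℤ :=
  Polynomial.X * (∏ i ∈ s, (1 - Polynomial.X ^ (i + 1))) ^ 24

-- Since ℤ is discrete, coefficientwise convergence of the formal product means that each
-- coefficient is eventually constant.
open scoped PowerSeries.WithPiTopology in
theorem eventually_coeff_discriminantPartialProd (n : ℕ) :
    ∀ᶠ s in atTop, (discriminantPartialProd s).coeff n = ramanujanTau n := by
  have h : Tendsto (fun s : Finset ℕ => (discriminantPartialProd s : ℤ⟦X⟧)) atTop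
      (𝓝 ramanujanSeries) := by
    have := multipliable_one_sub_X_pow_pow_24.hasProd.const_mul (X : ℤ⟦X⟧)
    refine this.congr fun s => ?_
    have hcoe : ((∏ i ∈ s, (1 - Polynomial.X ^ (i + 1)) : Polynomial ℤ) : ℤ⟦X⟧) =
        ∏ i ∈ s, (1 - X ^ (i + 1)) := by
      rw [← Polynomial.coeToPowerSeries.ringHom_apply, map_prod]
      simp
    simp [discriminantPartialProd, Finset.prod_pow, hcoe]
  have h' := (PowerSeries.WithPiTopology.tendsto_iff_coeff_tendsto ℤ _ _ _).mp h n
  simp only [Polynomial.coeff_coe] at h'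
  simpa [nhds_discrete, ramanujanTau] using h'

/-- The `q`-expansion of the modular discriminant has coefficients `τ(n)`. -/
theorem discriminant_qExpansion_coeff (n : ℕ) :
    (UpperHalfPlane.qExpansion 1 ModularForm.discriminant).coeff n = ramanujanTau n := by
  have heval : ∀ (s : Finset ℕ) (z : ℂ),
      ((discriminantPartialProd s).map (Int.castRingHom ℂ)).eval z =
        z * (∏ i ∈ s, (1 - z ^ (i + 1))) ^ 24 := fun s z => by
    simp [discriminantPartialProd, Polynomial.eval_prod, Polynomial.map_prod]
  have hlim : TendstoLocallyUniformlyOn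
      (fun s z => ((discriminantPartialProd s).map (Int.castRingHom ℂ)).eval z)
      (UpperHalfPlane.cuspFunction 1 ModularForm.discriminant) atTop (Metric.ball 0 1) := by
    have hid : TendstoLocallyUniformlyOn (fun (_ : Finset ℕ) (z : ℂ) => z) (fun z => z) atTop
        (Metric.ball 0 1) :=
      fun u hu x _ => ⟨Set.univ, univ_mem, .of_forall fun _ _ _ => refl_mem_uniformity hu⟩
    have h := hid.mul₀ (tendstoLocallyUniformlyOn_prod_one_sub_pow_pow 24) continuousOn_id
      (ModularForm.differentiableOn_tprod_one_sub_pow.continuousOn.pow 24)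
    refine (h.congr fun s z _ => ?_).congr_right fun z hz => ?_
    · exact (heval s z).symm
    · rw [ModularForm.discriminant_cuspFunction_eqOn hz]
      simp [(ModularForm.multipliable_one_sub_pow (by simpa using hz)).tprod_pow]
  -- The n-th derivatives at 0 of the partial products have two limits, one analytic and one formal;
  -- uniqueness of limits identifies them.
  have ht := tendsto_iteratedDeriv_of_tendstoLocallyUniformlyOn Metric.isOpen_ball hlim
    (fun s => (Polynomial.differentiable _).differentiableOn) (Metric.mem_ball_self one_pos) n
  have hev : Tendsto (fun s => iteratedDeriv n
      (fun z => ((discriminantPartialProd s).map (Int.castRingHom ℂ)).eval z) 0) atTop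
      (𝓝 (n.factorial * (ramanujanTau n : ℂ))) := by
    refine tendsto_const_nhds.congr' ?_
    filter_upwards [eventually_coeff_discriminantPartialProd n] with s hs
    rw [Polynomial.iteratedDeriv_eval_zero, Polynomial.coeff_map, hs, eq_intCast]
  rw [UpperHalfPlane.qExpansion_coeff, tendsto_nhds_unique ht hev]
  field_simp [Nat.factorial_ne_zero]

end DiscriminantQExpansion

/-! ### Parity of τ at primes, via Eisenstein series -/

section Parity

open PowerSeries
open scoped ArithmeticFunction.sigma MatrixGroups

/-- The generating series `∑ σ_k(n) q ^ n`. -/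
noncomputable def sigmaSeries (k : ℕ) : ℤ⟦X⟧ := mk fun n => (σ k n : ℤ)

theorem E₄_qExpansion :
    UpperHalfPlane.qExpansion 1 ModularForm.E₄ =
      (1 + 240 • sigmaSeries 3).map (Int.castRingHom ℂ) := by
  ext n
  -- The coefficient -2k/B_k is 240 for k = 4, and likewise -504 for k = 6.
  have h4 : bernoulli 4 = -1 / 30 := by
    rw [bernoulli_eq_bernoulli'_of_ne_one (by decide), bernoulli'_four]
  rw [EisensteinSeries.E_qExpansion_coeff _ ⟨2, rfl⟩, h4, coeff_map, map_add, map_nsmul]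
  by_cases hn : n = 0
  · simp [hn, sigmaSeries]
  · simp [hn, coeff_one, sigmaSeries]
    ring

theorem E₆_qExpansion :
    UpperHalfPlane.qExpansion 1 ModularForm.E₆ =
      (1 - 504 • sigmaSeries 5).map (Int.castRingHom ℂ) := by
  ext n
  have h6 : bernoulli 6 = 1 / 42 := by
    rw [bernoulli_eq_bernoulli'_of_ne_one (by decide)]
    decide +kernel
  rw [EisensteinSeries.E_qExpansion_coeff _ ⟨3, rfl⟩, h6, coeff_map, map_sub, map_nsmul]
  by_cases hn : n = 0
  · simp [hn, sigmaSeries]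
  · simp [hn, coeff_one, sigmaSeries]
    ring

theorem ramanujanSeries_eq :
    1728 • ramanujanSeries = (1 + 240 • sigmaSeries 3) ^ 3 - (1 - 504 • sigmaSeries 5) ^ 2 := by
  apply PowerSeries.map_injective (Int.castRingHom ℂ) (Int.cast_injective (α := ℂ))
  set F : ModularForm 𝒮ℒ 12 := ModularForm.mcast (by decide) (ModularForm.E₄.pow 3) -
    ModularForm.mcast (by decide) (ModularForm.E₆.pow 2) with hF
  have hFΔ : (F : UpperHalfPlane → ℂ) = (1728 : ℂ) • CuspForm.discriminant := by
    ext z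
    simp only [hF, ModularForm.coe_mcast, ModularForm.coe_pow, _root_.sub_apply, Pi.pow_apply,
      Pi.smul_apply, CuspForm.coe_discriminant, ModularForm.discriminant_eq_E₄_cube_sub_E₆_sq,
      smul_eq_mul]
    ring
  have h1 := ModularForm.qExpansion_smul one_pos one_mem_strictPeriods_SL (1728 : ℂ)
    CuspForm.discriminant
  have h2 : UpperHalfPlane.qExpansion 1 F = UpperHalfPlane.qExpansion 1 ModularForm.E₄ ^ 3 -
      UpperHalfPlane.qExpansion 1 ModularForm.E₆ ^ 2 := by
    simp only [hF, FunLike.coe_sub, ModularForm.coe_mcast,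
      ModularForm.qExpansion_sub one_pos one_mem_strictPeriods_SL,
      ModularForm.qExpansion_pow one_pos one_mem_strictPeriods_SL]
  rw [map_sub, map_pow, map_pow, ← E₄_qExpansion, ← E₆_qExpansion, ← h2, hFΔ]
  erw [h1]
  ext n
  rw [map_nsmul, map_nsmul, coeff_map, map_smul, CuspForm.coe_discriminant,
    discriminant_qExpansion_coeff, ramanujanTau]
  simp

/-- The expanded identity for 1728 Δ, divided by 144. The factor 12 that remains on the left means
that parity of τ has to be read off modulo 24. -/
theorem twelve_mul_ramanujanTau (n : ℕ) :
    12 * ramanujanTau n = 5 * σ 3 n + 7 * σ 5 n + 1200 * coeff n (sigmaSeries 3 ^ 2) +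
      96000 * coeff n (sigmaSeries 3 ^ 3) - 1764 * coeff n (sigmaSeries 5 ^ 2) := by
  have h : 1728 • ramanujanSeries = 720 • sigmaSeries 3 + 172800 • sigmaSeries 3 ^ 2 +
      13824000 • sigmaSeries 3 ^ 3 + 1008 • sigmaSeries 5 - 254016 • sigmaSeries 5 ^ 2 := by
    rw [ramanujanSeries_eq]
    simp only [nsmul_eq_mul]
    push_cast
    ring
  have hn := congrArg (coeff n) h
  simp only [map_add, map_sub, map_nsmul] at hn
  have h3 : coeff n (sigmaSeries 3) = σ 3 n := by simp [sigmaSeries]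
  have h5 : coeff n (sigmaSeries 5) = σ 5 n := by simp [sigmaSeries]
  simp only [h3, h5, nsmul_eq_mul] at hn
  push_cast at hn
  unfold ramanujanTau
  linarith

/-- Swapping the two indices of the convolution has no fixed point when n is odd, so the terms
cancel in pairs modulo 2. -/
theorem PowerSeries.even_coeff_sq_of_odd (f : ℤ⟦X⟧) {n : ℕ} (hn : Odd n) :
    Even (coeff n (f ^ 2)) := by
  rw [← ZMod.intCast_eq_zero_iff_even, sq, coeff_mul]
  push_cast
  refine Finset.sum_involution (fun x _ => x.swap) ?_ ?_ ?_ ?_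
  · intro x _
    rw [Prod.fst_swap, Prod.snd_swap, mul_comm, ← two_mul]
    exact mul_eq_zero_of_left (by decide) _
  · intro x hx _ h
    have hx := Finset.HasAntidiagonal.mem_antidiagonal.mp hx
    have : x.2 = x.1 := congrArg Prod.fst h
    obtain ⟨k, hk⟩ := hn
    omega
  · intro x hx
    simpa [add_comm] using hx
  · intro x _
    exact x.swap_swap

theorem even_ramanujanTau_of_prime {l : ℕ} (hl : l.Prime) : Even (ramanujanTau l) := by
  have hσ : ∀ k, (σ k l : ℤ) = 1 + l ^ k := fun k => by
    have := ArithmeticFunction.sigma_apply_prime_pow (k := k) (i := 1) hl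
    rw [pow_one] at this
    simp [this, Finset.sum_range_succ]
  have h := twelve_mul_ramanujanTau l
  rw [hσ, hσ] at h
  rcases hl.eq_two_or_odd' with rfl | hodd
  -- For l = 2 the square has the odd coefficient σ₅(1)² = 1, and 5·9 + 7·33 - 1764 = -24·62.
  · have h5 : coeff 2 (sigmaSeries 5 ^ 2) = 1 := by
      simp [sq, coeff_mul, Finset.Nat.antidiagonal_succ, sigmaSeries]
    rw [h5] at h
    push_cast at h
    exact ⟨-62 + 50 * coeff 2 (sigmaSeries 3 ^ 2) + 4000 * coeff 2 (sigmaSeries 3 ^ 3), by linarith⟩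
  · obtain ⟨c, hc⟩ := PowerSeries.even_coeff_sq_of_odd (sigmaSeries 5) hodd
    have hmod : ∃ m : ℤ, 5 * (l : ℤ) ^ 3 + 7 * (l : ℤ) ^ 5 = 12 + 24 * m := by
      -- With the constant 5 + 7 = 12 from the two divisor sums, this gives 24 modulo 24; the other
      -- terms are divisible by 24 because 1764 · 2 = 24 · 147.
      have h24 : ∀ x : ZMod 24, 5 * (2 * x + 1) ^ 3 + 7 * (2 * x + 1) ^ 5 - 12 = 0 := by decide
      obtain ⟨r, hr⟩ := hodd
      have hdvd : (24 : ℤ) ∣ 5 * (l : ℤ) ^ 3 + 7 * (l : ℤ) ^ 5 - 12 := by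
        refine (ZMod.intCast_zmod_eq_zero_iff_dvd _ 24).mp ?_
        rw [hr]
        push_cast
        exact h24 r
      obtain ⟨m, hm⟩ := hdvd
      exact ⟨m, by linarith⟩
    obtain ⟨m, hm⟩ := hmod
    rw [hc] at h
    exact ⟨1 + m + 50 * coeff l (sigmaSeries 3 ^ 2) + 4000 * coeff l (sigmaSeries 3 ^ 3)
      - 147 * c, by linarith⟩

end Parity

/-! ### Modular invariance of the Hecke sum -/

section HeckeInvariance

open UpperHalfPlane ModularForm
open scoped MatrixGroups ModularForm

/-- The matrix `(a b; 0 d)` as an element of `GL(2, ℝ)`. -/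
noncomputable def upperTriangularGL (a b d : ℝ) (ha : a ≠ 0) (hd : d ≠ 0) : GL (Fin 2) ℝ :=
  .mkOfDetNeZero !![a, b; 0, d] (by simp [ha, hd])

variable (l : ℕ) [NeZero l]

/-- The matrix `(1 j; 0 l)`. -/
noncomputable def heckeMatrix (j : ℤ) : GL (Fin 2) ℝ :=
  upperTriangularGL 1 j l one_ne_zero (NeZero.ne _)

/-- The matrix `(l 0; 0 1)`. -/
noncomputable def heckeMatrixInfty : GL (Fin 2) ℝ :=
  upperTriangularGL l 0 1 (NeZero.ne _) one_ne_zero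

variable {k : ℤ}

/-- The `l`-th Hecke operator of weight `k` for prime `l`, on functions on the upper half plane. -/
noncomputable def heckeSum (k : ℤ) (f : ℍ → ℂ) : ℍ → ℂ :=
  f ∣[k] heckeMatrixInfty l + ∑ j : ZMod l, f ∣[k] heckeMatrix l j.val

variable {l} {f : ℍ → ℂ}

/-- The Hecke matrices represent cosets of SL(2,ℤ) acting on the left, and right multiplication by δ
permutes these cosets. Each case reduces to exhibiting γ with A δ = γ B. -/
theorem slash_slash_of_mul_eq (hf : ∀ γ : SL(2, ℤ), f ∣[k] γ = f) (γ δ : SL(2, ℤ))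
    {A B : GL (Fin 2) ℝ}
    (h : A.val * δ.val.map (Int.cast : ℤ → ℝ) = γ.val.map (Int.cast : ℤ → ℝ) * B.val) :
    (f ∣[k] A) ∣[k] δ = f ∣[k] B := by
  have h' : A * (δ : GL (Fin 2) ℝ) = (γ : GL (Fin 2) ℝ) * B := Units.ext h
  rw [SL_slash, ← SlashAction.slash_mul, h', SlashAction.slash_mul, ← SL_slash, hf]

theorem slash_heckeMatrix_add_mul (hf : ∀ γ : SL(2, ℤ), f ∣[k] γ = f) (j m : ℤ) :
    f ∣[k] heckeMatrix l (j + l * m) = f ∣[k] heckeMatrix l j := by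
  have := slash_slash_of_mul_eq hf ⟨!![1, m; 0, 1], by simp⟩ 1
    (A := heckeMatrix l (j + l * m)) (B := heckeMatrix l j) (by
      ext a b
      fin_cases a <;> fin_cases b <;>
        simp [heckeMatrix, upperTriangularGL, Matrix.mul_apply, Fin.sum_univ_two, mul_comm])
  simpa using this

theorem slash_heckeMatrix_congr (hf : ∀ γ : SL(2, ℤ), f ∣[k] γ = f) {i j : ℤ}
    (h : (i : ZMod l) = j) : f ∣[k] heckeMatrix l i = f ∣[k] heckeMatrix l j := by
  rw [ZMod.intCast_eq_intCast_iff_dvd_sub] at h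
  obtain ⟨m, hm⟩ := h
  rw [show j = i + l * m by linarith, slash_heckeMatrix_add_mul hf]

theorem heckeSum_slash_T (hf : ∀ γ : SL(2, ℤ), f ∣[k] γ = f) :
    (heckeSum l k f) ∣[k] ModularGroup.T = heckeSum l k f := by
  have h1 : (f ∣[k] heckeMatrixInfty l) ∣[k] ModularGroup.T = f ∣[k] heckeMatrixInfty l :=
    slash_slash_of_mul_eq hf ⟨!![1, l; 0, 1], by simp⟩ _ (by
      ext a b
      fin_cases a <;> fin_cases b <;>
        simp [heckeMatrixInfty, upperTriangularGL, Matrix.mul_apply, Fin.sum_univ_two,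
          ModularGroup.T])
  have h2 : ∀ j : ℤ, (f ∣[k] heckeMatrix l j) ∣[k] ModularGroup.T =
      f ∣[k] heckeMatrix l (j + 1) := fun j =>
    slash_slash_of_mul_eq hf 1 _ (by
      ext a b
      fin_cases a <;> fin_cases b <;>
        simp [heckeMatrix, upperTriangularGL, Matrix.mul_apply, Fin.sum_univ_two,
          ModularGroup.T, add_comm])
  rw [heckeSum, SlashAction.add_slash, SlashAction.sum_slash, h1]
  congr 1
  refine Fintype.sum_equiv (Equiv.addRight 1) _ _ fun j => ?_
  rw [h2]
  exact slash_heckeMatrix_congr hf (by simp)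

/-- The summands are indexed by the projective line over 𝔽_l, on which S acts by j ↦ -1/j,
exchanging 0 and ∞. -/
theorem heckeSum_slash_S [Fact l.Prime] (hf : ∀ γ : SL(2, ℤ), f ∣[k] γ = f) :
    (heckeSum l k f) ∣[k] ModularGroup.S = heckeSum l k f := by
  have h1 : (f ∣[k] heckeMatrixInfty l) ∣[k] ModularGroup.S = f ∣[k] heckeMatrix l 0 :=
    slash_slash_of_mul_eq hf ModularGroup.S _ (by
      ext a b
      fin_cases a <;> fin_cases b <;>
        simp [heckeMatrixInfty, heckeMatrix, upperTriangularGL, Matrix.mul_apply,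
          Fin.sum_univ_two, ModularGroup.S])
  have h2 : (f ∣[k] heckeMatrix l 0) ∣[k] ModularGroup.S = f ∣[k] heckeMatrixInfty l :=
    slash_slash_of_mul_eq hf ModularGroup.S _ (by
      ext a b
      fin_cases a <;> fin_cases b <;>
        simp [heckeMatrixInfty, heckeMatrix, upperTriangularGL, Matrix.mul_apply,
          Fin.sum_univ_two, ModularGroup.S])
  have h3 : ∀ i j : ℤ, (i : ZMod l) * j = -1 →
      (f ∣[k] heckeMatrix l i) ∣[k] ModularGroup.S = f ∣[k] heckeMatrix l j := by
    intro i j hij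
    -- This b completes (i b; l -j) to determinant 1, and (1 i; 0 l) S = (i b; l -j)(1 j; 0 l).
    obtain ⟨b, hb⟩ : (l : ℤ) ∣ -1 - i * j := by
      rw [← ZMod.intCast_eq_intCast_iff_dvd_sub]
      simpa using hij
    have hbR : (-1 : ℝ) - i * j = l * b := by exact_mod_cast hb
    refine slash_slash_of_mul_eq hf ⟨!![i, b; l, -j], ?_⟩ _ ?_
    · rw [Matrix.det_fin_two_of]
      linarith
    · ext a b
      fin_cases a <;> fin_cases b <;>
        simp [heckeMatrix, upperTriangularGL, Matrix.mul_apply, Fin.sum_univ_two, ModularGroup.S]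
      · linarith
      · ring
  have hsplit : ∀ g : ZMod l → ℍ → ℂ, ∑ j, g j = g 0 + ∑ j ∈ Finset.univ.erase 0, g j :=
    fun g => (Finset.add_sum_erase _ _ (Finset.mem_univ _)).symm
  rw [heckeSum, SlashAction.add_slash, SlashAction.sum_slash, h1, hsplit, hsplit]
  simp only [ZMod.val_zero, Nat.cast_zero, h2]
  rw [← add_assoc, ← add_assoc, add_comm (f ∣[k] heckeMatrix l 0)]
  congr 1
  refine Finset.sum_nbij' (fun j => -j⁻¹) (fun j => -j⁻¹) ?_ ?_ ?_ ?_ ?_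
  · simp
  · simp
  · simp [inv_neg]
  · simp [inv_neg]
  · intro j hj
    apply h3
    simp [Finset.ne_of_mem_erase hj]

end HeckeInvariance

/-! ### Hecke operators on cusp forms and on q-expansions -/

section HeckeCuspForm

open UpperHalfPlane ModularForm
open scoped MatrixGroups ModularForm

/-- The image of a level one cusp form under the `l`-th Hecke operator. -/
noncomputable def heckeCuspForm (l : ℕ) [Fact l.Prime] {k : ℤ} (f : CuspForm 𝒮ℒ k) :
    CuspForm 𝒮ℒ k :=
  have hf : ∀ γ : SL(2, ℤ), (f : ℍ → ℂ) ∣[k] γ = f := fun γ => f.slash_action_eq' _ ⟨γ, rfl⟩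
  have hinv : ∀ γ : SL(2, ℤ), (heckeSum l k f) ∣[k] γ = heckeSum l k f :=
    SlashInvariantForm.slash_action_generators_SL2Z (heckeSum_slash_S hf) (heckeSum_slash_T hf)
  { toFun := heckeSum l k f
    slash_action_eq' := by
      rintro _ ⟨γ, rfl⟩
      exact hinv γ
    holo' := by
      have h : MDifferentiable (modelWithCornersSelf ℂ ℂ) (modelWithCornersSelf ℂ ℂ) f := f.holo'
      exact (h.slash k _).add (MDifferentiable.sum fun j _ => h.slash k _)
    zero_at_cusps' := fun hc => by
      rw [Subgroup.IsArithmetic.isCusp_iff_isCusp_SL2Z] at hc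
      rw [OnePoint.isZeroAt_iff_forall_SL2Z hc]
      intro γ _
      -- Every cusp is a translate of ∞, so invariance leaves only ∞ to check; the upper triangular
      -- Hecke matrices fix it.
      rw [hinv]
      have h : IsZeroAtImInfty f := CuspFormClass.zero_at_infty f
      have hsum : ∀ s : Finset (ZMod l),
          IsZeroAtImInfty (∑ j ∈ s, (f : ℍ → ℂ) ∣[k] heckeMatrix l j.val) := fun s => by
        induction s using Finset.cons_induction with
        | empty => exact Filter.zero_zeroAtFilter _
        | cons a s ha ih =>
          rw [Finset.sum_cons]
          exact (h.slash k (by simp [heckeMatrix, upperTriangularGL])).add ih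
      exact (h.slash k (by simp [heckeMatrixInfty, upperTriangularGL])).add (hsum _) }

/-- The slash action carries the factor det^(k-1), so the Hecke sum is l^(k-1) f(lz) + l⁻¹ ∑
f((z+j)/l) with no further normalisation. -/
theorem slash_upperTriangularGL_apply {k : ℤ} (f : ℍ → ℂ) {a b d : ℝ} (ha : 0 < a) (hd : 0 < d)
    (z : ℍ) : ∃ w : ℍ, (w : ℂ) = (a * z + b) / d ∧
      (f ∣[k] upperTriangularGL a b d ha.ne' hd.ne') z =
        f w * (a * d) ^ (k - 1) * (d : ℂ) ^ (-k) := by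
  have hdet : (upperTriangularGL a b d ha.ne' hd.ne').det.val = a * d := by
    simp [upperTriangularGL]
  have hpos : 0 < (upperTriangularGL a b d ha.ne' hd.ne').det.val := hdet ▸ mul_pos ha hd
  refine ⟨upperTriangularGL a b d ha.ne' hd.ne' • z, ?_, ?_⟩
  · rw [coe_smul_of_det_pos hpos]
    simp [num, denom, upperTriangularGL]
  · rw [slash_apply, hdet, abs_of_pos (mul_pos ha hd), σ, if_pos hpos]
    simp [denom, upperTriangularGL]

/-- Orthogonality of characters: a geometric sum of l-th roots of unity vanishes unless the ratio is
1. -/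
theorem sum_range_exp_pow (l n : ℕ) [NeZero l] :
    ∑ j ∈ Finset.range l, Complex.exp (2 * Real.pi * Complex.I * j / l) ^ n =
      if l ∣ n then (l : ℂ) else 0 := by
  have hζ := Complex.isPrimitiveRoot_exp l (NeZero.ne l)
  set ζ := Complex.exp (2 * Real.pi * Complex.I / l) with hζdef
  have h1 : ∀ j : ℕ, Complex.exp (2 * Real.pi * Complex.I * j / l) ^ n = (ζ ^ n) ^ j := fun j => by
    rw [hζdef, ← Complex.exp_nat_mul, ← Complex.exp_nat_mul, ← Complex.exp_nat_mul]
    congr 1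
    ring
  simp only [h1]
  split_ifs with h
  · simp [(hζ.pow_eq_one_iff_dvd n).mpr h]
  · have hne : ζ ^ n - 1 ≠ 0 := sub_ne_zero.mpr (mt (hζ.pow_eq_one_iff_dvd n).mp h)
    have hgeom := geom_sum_mul (ζ ^ n) l
    rw [← pow_mul, mul_comm n, pow_mul, hζ.pow_eq_one, one_pow, sub_self] at hgeom
    exact (mul_eq_zero.mp hgeom).resolve_right hne

/-- The effect of the `l`-th Hecke operator on `q`-expansions. -/
theorem hasSum_heckeSum (l : ℕ) [NeZero l] {k : ℕ} {f : ℍ → ℂ} {a : ℕ → ℂ} (hk : 0 < k)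
    (hf : ∀ z : ℍ, HasSum (fun m => a m * Function.Periodic.qParam 1 z ^ m) (f z)) (z : ℍ) :
    HasSum (fun m => (a (l * m) + if l ∣ m then (l : ℂ) ^ (k - 1) * a (m / l) else 0) *
      Function.Periodic.qParam 1 z ^ m) (heckeSum l k f z) := by
  have hl0 : (l : ℂ) ≠ 0 := NeZero.ne _
  have hlpos : (0 : ℝ) < l := Nat.cast_pos.mpr (NeZero.pos l)
  have hinj : Function.Injective (fun m : ℕ => l * m) :=
    fun x y h => Nat.eq_of_mul_eq_mul_left (NeZero.pos l) h
  have hinf : HasSum (fun m => (if l ∣ m then (l : ℂ) ^ (k - 1) * a (m / l) else 0) *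
      Function.Periodic.qParam 1 z ^ m) ((f ∣[(k : ℤ)] heckeMatrixInfty l) z) := by
    obtain ⟨w, hw, hval⟩ := slash_upperTriangularGL_apply (k := k) f (b := 0) hlpos one_pos z
    have hval' : (f ∣[(k : ℤ)] heckeMatrixInfty l) z = (l : ℂ) ^ (k - 1) * f w := by
      refine hval.trans ?_
      have : ((k : ℤ) - 1) = ((k - 1 : ℕ) : ℤ) := by omega
      rw [this, zpow_natCast]
      simp [mul_comm]
    have hq : Function.Periodic.qParam 1 w = Function.Periodic.qParam 1 z ^ l := by
      simp only [Function.Periodic.qParam, hw, ← Complex.exp_nat_mul]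
      congr 1
      push_cast
      ring
    rw [hval', ← hinj.hasSum_iff]
    · refine ((hf w).mul_left ((l : ℂ) ^ (k - 1))).congr_fun fun m => ?_
      simp [hq, Nat.mul_div_cancel_left _ (NeZero.pos l), pow_mul, mul_assoc]
    · intro x hx
      rw [if_neg, zero_mul]
      rintro ⟨m, rfl⟩
      exact hx ⟨m, rfl⟩
  have hfin : HasSum (fun m => a (l * m) * Function.Periodic.qParam 1 z ^ m)
      (∑ j ∈ Finset.range l, (f ∣[(k : ℤ)] heckeMatrix l j) z) := by
    -- Q is an l-th root of q. The shift by j multiplies Q by an l-th root of unity, so averaging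
    -- over j keeps only exponents divisible by l.
    set Q := Function.Periodic.qParam l z with hQ
    have hj : ∀ j : ℕ, HasSum (fun n => (l : ℂ)⁻¹ *
        (a n * (Complex.exp (2 * Real.pi * Complex.I * j / l) ^ n * Q ^ n)))
        ((f ∣[(k : ℤ)] heckeMatrix l j) z) := fun j => by
      obtain ⟨w, hw, hval⟩ := slash_upperTriangularGL_apply (k := k) f (b := j) one_pos hlpos z
      have hval' : (f ∣[(k : ℤ)] heckeMatrix l j) z = (l : ℂ)⁻¹ * f w := by
        have hM : heckeMatrix l j = upperTriangularGL 1 j l one_pos.ne' hlpos.ne' := by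
          simp [heckeMatrix]
        rw [hM, hval, mul_assoc, mul_comm]
        congr 1
        push_cast
        rw [one_mul, ← zpow_add₀ hl0, show (k : ℤ) - 1 + -k = -1 by ring, zpow_neg_one]
      have hq : Function.Periodic.qParam 1 w =
          Complex.exp (2 * Real.pi * Complex.I * j / l) * Q := by
        simp only [hQ, Function.Periodic.qParam, hw, ← Complex.exp_add]
        congr 1
        push_cast
        field_simp
        ring
      rw [hval']
      refine ((hf w).mul_left _).congr_fun fun n => ?_
      rw [hq, mul_pow]
    have hsum := hasSum_sum (s := Finset.range l) fun j _ => hj j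
    have hpow : Function.Periodic.qParam 1 z = Q ^ l := by
      simp only [hQ, Function.Periodic.qParam, ← Complex.exp_nat_mul]
      congr 1
      push_cast
      field_simp
    have hterm : ∀ n, ∑ j ∈ Finset.range l, (l : ℂ)⁻¹ *
        (a n * (Complex.exp (2 * Real.pi * Complex.I * j / l) ^ n * Q ^ n)) =
        if l ∣ n then a n * Q ^ n else 0 := fun n => by
      have := sum_range_exp_pow l n
      simp only [← Finset.mul_sum, ← Finset.sum_mul, this]
      split_ifs
      · field_simp
      · simp
    simp only [hterm] at hsum
    rw [← hinj.hasSum_iff] at hsum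
    · convert hsum using 1
      ext m
      simp [hpow, pow_mul]
    · intro x hx
      rw [if_neg]
      rintro ⟨m, rfl⟩
      exact hx ⟨m, rfl⟩
  have hZ : ∑ j : ZMod l, (f ∣[(k : ℤ)] heckeMatrix l j.val) z =
      ∑ j ∈ Finset.range l, (f ∣[(k : ℤ)] heckeMatrix l j) z := by
    obtain ⟨n, rfl⟩ := Nat.exists_eq_succ_of_ne_zero (NeZero.ne l)
    exact Fin.sum_univ_eq_sum_range (fun j => (f ∣[(k : ℤ)] heckeMatrix (n + 1) j) z) (n + 1)
  have htot := hfin.add hinf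
  rw [heckeSum, Pi.add_apply, Finset.sum_apply, hZ, add_comm]
  convert htot using 1
  ext m
  ring

end HeckeCuspForm

/-! ### Hecke relations for τ and the conclusion -/

theorem ramanujanTau_one : ramanujanTau 1 = 1 := by
  have : (ramanujanTau 1 : ℂ) = 1 := by
    rw [← discriminant_qExpansion_coeff, ModularForm.discriminant_qExpansion_coeff_one]
  exact_mod_cast this

/-- The modular discriminant is an eigenform of the Hecke operators. -/
theorem ramanujanTau_mul_prime {l : ℕ} (hl : l.Prime) (m : ℕ) :
    ramanujanTau (l * m) + (if l ∣ m then (l : ℤ) ^ 11 * ramanujanTau (m / l) else 0) =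
      ramanujanTau l * ramanujanTau m := by
  have : Fact l.Prime := ⟨hl⟩
  have hΔ (z : UpperHalfPlane) := ModularForm.hasSum_qExpansion (f := CuspForm.discriminant)
    (h := 1) one_pos one_mem_strictPeriods_SL z
  simp only [CuspForm.coe_discriminant, discriminant_qExpansion_coeff] at hΔ
  have hT := hasSum_heckeSum l (k := 12) (by norm_num) hΔ
  -- One-dimensionality of the weight 12 cusp forms makes the discriminant an eigenform, with some
  -- eigenvalue c.
  obtain ⟨c, hc⟩ := CuspForm.exists_smul_discriminant_of_weight_eq_twelve
    (heckeCuspForm l CuspForm.discriminant)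
  have hcoeff (m : ℕ) : ((ramanujanTau (l * m) : ℂ) +
      if l ∣ m then (l : ℂ) ^ 11 * ramanujanTau (m / l) else 0) = c * ramanujanTau m := by
    have h1 := ModularFormClass.qExpansion_coeff_unique one_pos one_mem_strictPeriods_SL
      (f := heckeCuspForm l CuspForm.discriminant) hT m
    have h2 := ModularForm.qExpansion_smul one_pos one_mem_strictPeriods_SL c CuspForm.discriminant
    have h3 : (heckeCuspForm l CuspForm.discriminant : UpperHalfPlane → ℂ) =
        c • CuspForm.discriminant := (congrArg DFunLike.coe hc).symm
    rw [h3] at h1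
    refine h1.trans ?_
    erw [h2]
    rw [map_smul, CuspForm.coe_discriminant, discriminant_qExpansion_coeff, smul_eq_mul]
  -- As τ(1) = 1 and l does not divide 1, the first coefficient gives c = τ(l).
  have hcl := hcoeff 1
  rw [mul_one, if_neg (mt Nat.dvd_one.mp hl.ne_one), add_zero, ramanujanTau_one, Int.cast_one,
    mul_one] at hcl
  have := hcoeff m
  rw [← hcl] at this
  exact_mod_cast this

theorem ramanujanTau_prime_pow_add_two {l : ℕ} (hl : l.Prime) (n : ℕ) :
    ramanujanTau (l ^ (n + 2)) =
      ramanujanTau l * ramanujanTau (l ^ (n + 1)) - (l : ℤ) ^ 11 * ramanujanTau (l ^ n) := by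
  have h := ramanujanTau_mul_prime hl (l ^ (n + 1))
  rw [if_pos (dvd_pow_self l n.succ_ne_zero), pow_succ l n, Nat.mul_div_cancel _ hl.pos,
    ← pow_succ, ← pow_succ'] at h
  linarith

theorem mainTheorem8 (l : ℕ) (hl : l.Prime) (p : ℕ) [Fact p.Prime]
    (hp : IsCoprime (p : ℤ) (ramanujanDisc l)) :
    (legendreSym p (ramanujanDisc l) = 1 →
      ramanujanTau (l ^ p) ≡ ramanujanTau l [ZMOD (p : ℤ)]) ∧
    (legendreSym p (ramanujanDisc l) = -1 →
      ramanujanTau (l ^ p) ≡ 0 [ZMOD (p : ℤ)]) := by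
  -- Both τ(l)² and 4 l^11 are even, so 2 is not coprime to the discriminant.
  have hp2 : p ≠ 2 := by
    rintro rfl
    have hdvd : (2 : ℤ) ∣ ramanujanDisc l := by
      have h := (even_ramanujanTau_of_prime hl).two_dvd
      exact dvd_sub (dvd_pow h two_ne_zero)
        (Dvd.intro _ (by ring : (2 : ℤ) * (2 * (l : ℤ) ^ 11) = _))
    have := hp.isUnit_of_dvd' (dvd_refl _) (by exact_mod_cast hdvd)
    norm_num [Int.isUnit_iff] at this
  exact lucas_prime_mod hp2 (u := fun n => ramanujanTau (l ^ n)) (by simp [ramanujanTau_one])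
    (by simp) (ramanujanTau_prime_pow_add_two hl)
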